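/- Let $q=p^m$ be a prime power, let $r\ge 3$ be an integer, and put $n_r=(q^r-1)/(q-1)$. Let $G\in\mathbb F_q^{r\times n_r}$ be a generator matrix of the $q$-ary simplex code $S(q,r)$: the columns of $G$ are nonzero representatives of the points of the projective space $PG(r-1,q)$, exactly one for each point. Let $H$ be a parity-check matrix of this code over $\mathbb F_q$, i.e. $\ker H=\{c : Hc=0\}$ is the row space of $G$. Let $\mathcal P$ be the Pauli group of Galois qudits of dimension $q$ arranged on an $n_r\times n_r$ lattice. It consists of the operators $c\,Z^{b}X^{a}$ with $a,b\in\mathbb F_q^{n_r}\otimes\mathbb F_q^{n_r}$, where $X^a|x\rangle=|x+a\rangle$ and $Z^b|x\rangle=\omega^{\operatorname{Tr}(b\cdot x)}|x\rangle$ with $\omega=e^{2\pi i/p}$, and where $c$ is a power of $\omega$ (for $q$ even, a power of $i$). Let $\mathcal G\le\mathcal P$ be the gauge group of the subsystem hypergraph product of two copies of $H$: it is generated by all the phases $c$, all $X^a$ with $a$ in the $\mathbb F_q$-row space of $G_X=H\otimes I_{n_r}$, and all $Z^b$ with $b$ in the $\mathbb F_q$-row space of $G_Z=I_{n_r}\otimes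 H$. Let $\mathcal S$ be the group generated by the operators $X^a$ and $Z^b$ (without phases) that lie in the center $Z(\mathcal G)=C_{\mathcal P}(\mathcal G)\cap\mathcal G$. Then $(\mathcal G,\mathcal S)$ defines a quantum subsystem code, $\mathrm{SHYPS}(q,r)$, with parameters $[[n,k,d]]_q$, where $$n=\left(\frac{q^r-1}{q-1}\right)^2,\qquad k=r^2,\qquad d=q^{r-1}.$$ That is: 1. The number of physical qudits is $n$. 2. $\mathcal S$ contains no scalar operator other than the identity, and together with the phases it generates $Z(\mathcal G)$. 3. For some $g\ge 0$ there is a unitary isomorphism of the space of states fixed by $\mathcal S$ with $C_L\otimes C_G$, where $C_L=(\mathbb C^q)^{\otimes k}$ consists of $k$ logical qudits and $C_G=(\mathbb C^q)^{\otimes g}$ of $g$ gauge qudits. Under it, $\mathcal G$ acts as exactly the Pauli group of the gauge qudits (with the identity on $C_L$), and $C_{\mathcal P}(\mathcal G)$ acts as exactly the Pauli group of the logical qudits (with the identity on $C_G$). 4. The minimum weight of an element of $C_{\mathcal P}(\mathcal S)\setminus\mathcal G$ is equal to $d$, where the weight of an operator is the number of its tensor factors that are not multiples of the identity. -/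

import Mathlib

open scoped Kronecker

noncomputable section

namespace Qudit

/-! ### Galois qudits and their Pauli group -/

section Pauli

variable (p : ℕ) [Fact p.Prime] {F : Type*} [Field F] [Algebra (ZMod p) F] {Q : Type*}

/-- The Hilbert space `(ℂ^q)^{⊗ Q}` of a finite family `Q` of Galois qudits over the finite field
`F`. Its orthonormal basis `|x⟩ = ⊗_j |x_j⟩` is indexed by the vectors `x : Q → F`, and a state is
given by its amplitudes in this basis. -/
abbrev Space (F Q : Type*) : Type _ := EuclideanSpace ℂ (Q → F)

/-- The character `α ↦ ω ^ Tr α` of `F`, where `ω = exp (2πi / p)` and `Tr : F → 𝔽_p` is the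
field trace. -/
def chr (α : F) : ℂ := ZMod.stdAddChar (Algebra.trace (ZMod p) F α)

lemma chr_add (α β : F) : chr p (α + β) = chr p α * chr p β := by
  simp [chr, AddChar.map_add_eq_mul]

lemma chr_zero : chr p (0 : F) = 1 := by simp [chr]

lemma chr_pow (α : F) : chr p α ^ p = 1 := by
  rw [chr, ← AddChar.map_nsmul_eq_pow]
  simp

lemma chr_neg_mul (α : F) : chr p (-α) * chr p α = 1 := by
  rw [← chr_add, neg_add_cancel, chr_zero]

/-- The operator `⊗_j X^{a_j}`, that is, `|x⟩ ↦ |x + a⟩`. -/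
def X (a : Q → F) : Space F Q ≃ₗ[ℂ] Space F Q where
  toFun ψ := WithLp.toLp 2 fun x => ψ (x - a)
  invFun ψ := WithLp.toLp 2 fun x => ψ (x + a)
  map_add' ψ φ := by ext x; simp
  map_smul' c ψ := by ext x; simp
  left_inv ψ := by ext x; simp
  right_inv ψ := by ext x; simp

@[simp] lemma X_apply (a : Q → F) (ψ : Space F Q) (x : Q → F) : X a ψ x = ψ (x - a) := rfl

/-- Multiplication by a nonzero scalar. -/
def phase {F Q : Type*} (c : ℂˣ) : Space F Q ≃ₗ[ℂ] Space F Q := LinearEquiv.smulOfUnit c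

@[simp] lemma phase_apply {F Q : Type*} (c : ℂˣ) (ψ : Space F Q) (x : Q → F) :
    phase c ψ x = (c : ℂ) * ψ x := rfl

/-- The phases of the Pauli group: the powers of `ω`, together with their multiples by `i` if the
characteristic is `2`. These are the `p`-th roots of unity for odd `p`, and the fourth roots of
unity for `p = 2`. -/
def phases : Subgroup ℂˣ := rootsOfUnity (if p = 2 then 4 else p) ℂ

lemma exists_phase_chr (α : F) : ∃ u ∈ phases p, (u : ℂ) = chr p α := by
  have h := chr_pow p α
  refine ⟨Units.mk0 (chr p α) ?_, ?_, rfl⟩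
  · intro h0
    rw [h0, zero_pow (Fact.out : p.Prime).ne_zero] at h
    exact zero_ne_one h
  · rw [phases, mem_rootsOfUnity, Units.ext_iff]
    split_ifs with h2
    · subst h2
      simp only [Units.val_pow_eq_pow_val, Units.val_mk0, Units.val_one]
      rw [show 4 = 2 * 2 from rfl, pow_mul, h, one_pow]
    · simpa using h

variable [Fintype Q]

/-- The operator `⊗_j Z^{b_j}`, that is, `|x⟩ ↦ ω ^ Tr (∑ j, b_j x_j) |x⟩`. -/
def Z (b : Q → F) : Space F Q ≃ₗ[ℂ] Space F Q where
  toFun ψ := WithLp.toLp 2 fun x => chr p (b ⬝ᵥ x) * ψ x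
  invFun ψ := WithLp.toLp 2 fun x => chr p (-(b ⬝ᵥ x)) * ψ x
  map_add' ψ φ := by ext x; simp [mul_add]
  map_smul' c ψ := by ext x; simp [mul_left_comm]
  left_inv ψ := by ext x; simp [← mul_assoc, chr_neg_mul]
  right_inv ψ := by
    ext x
    change chr p (b ⬝ᵥ x) * (chr p (-(b ⬝ᵥ x)) * ψ x) = ψ x
    rw [mul_left_comm, ← mul_assoc, chr_neg_mul, one_mul]

/-- The operator `c ⊗_j Z^{b_j} X^{a_j}`. -/
def pauli (c : ℂˣ) (b a : Q → F) : Space F Q ≃ₗ[ℂ] Space F Q := phase c * Z p b * X a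

@[simp] lemma Z_apply (b : Q → F) (ψ : Space F Q) (x : Q → F) :
    Z p b ψ x = chr p (b ⬝ᵥ x) * ψ x := rfl

lemma pauli_apply (c : ℂˣ) (b a : Q → F) (ψ : Space F Q) (x : Q → F) :
    pauli p c b a ψ x = (c : ℂ) * (chr p (b ⬝ᵥ x) * ψ (x - a)) := rfl

variable (F Q) in
/-- The Pauli group of the family `Q` of Galois qudits over `F`. -/
def pauliGroup : Subgroup (Space F Q ≃ₗ[ℂ] Space F Q) where
  carrier := {U | ∃ c ∈ phases p, ∃ b a : Q → F, U = pauli p c b a}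
  one_mem' := by
    refine ⟨1, one_mem _, 0, 0, ?_⟩
    ext ψ x
    simp [pauli_apply, chr_zero]
  mul_mem' := by
    rintro _ _ ⟨c, hc, b, a, rfl⟩ ⟨c', hc', b', a', rfl⟩
    obtain ⟨u, hu, hu'⟩ := exists_phase_chr p (-(b' ⬝ᵥ a))
    refine ⟨c * c' * u, mul_mem (mul_mem hc hc') hu, b + b', a + a', ?_⟩
    ext ψ x
    have h : chr p (b' ⬝ᵥ (x - a)) = chr p (b' ⬝ᵥ x) * chr p (-(b' ⬝ᵥ a)) := by
      rw [← chr_add, dotProduct_sub, sub_eq_add_neg]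
    simp only [LinearEquiv.mul_apply, pauli_apply, h, add_dotProduct, chr_add, Units.val_mul, hu',
      sub_add_eq_sub_sub]
    ring
  inv_mem' := by
    rintro _ ⟨c, hc, b, a, rfl⟩
    obtain ⟨u, hu, hu'⟩ := exists_phase_chr p (-(b ⬝ᵥ a))
    refine ⟨c⁻¹ * u, mul_mem (inv_mem hc) hu, -b, -a, ?_⟩
    rw [inv_eq_iff_mul_eq_one]
    ext ψ x
    have h : chr p (-b ⬝ᵥ (x - a)) = chr p (-(b ⬝ᵥ x)) * chr p (b ⬝ᵥ a) := by
      rw [← chr_add, dotProduct_sub, neg_dotProduct, neg_dotProduct, sub_neg_eq_add]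
    have h1 := chr_neg_mul p (b ⬝ᵥ x)
    have h2 := chr_neg_mul p (b ⬝ᵥ a)
    simp only [LinearEquiv.mul_apply, pauli_apply, h, Units.val_mul, hu',
      LinearEquiv.coe_one, id_eq, sub_neg_eq_add, sub_add_cancel]
    linear_combination
      (chr p (-(b ⬝ᵥ x)) * chr p (b ⬝ᵥ x) * chr p (-(b ⬝ᵥ a)) * chr p (b ⬝ᵥ a) * ψ x) *
        c.mul_inv + (chr p (-(b ⬝ᵥ a)) * chr p (b ⬝ᵥ a) * ψ x) * h1 + ψ x * h2

/-- The group of the scalar operators `c • 1` with `c` a phase of the Pauli group. -/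
def phaseGroup : Subgroup (Space F Q ≃ₗ[ℂ] Space F Q) where
  carrier := {U | ∃ c ∈ phases p, U = phase c}
  one_mem' := ⟨1, one_mem _, by ext ψ x; simp⟩
  mul_mem' := by
    rintro _ _ ⟨c, hc, rfl⟩ ⟨d, hd, rfl⟩
    exact ⟨c * d, mul_mem hc hd, by ext ψ x; simp [mul_assoc]⟩
  inv_mem' := by
    rintro _ ⟨c, hc, rfl⟩
    exact ⟨c⁻¹, inv_mem hc, by rw [inv_eq_iff_mul_eq_one]; ext ψ x; simp⟩

/-- The centralizer `C_P(𝒢)` of `𝒢` in the Pauli group. -/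
def pauliCentralizer (𝒢 : Subgroup (Space F Q ≃ₗ[ℂ] Space F Q)) :
    Subgroup (Space F Q ≃ₗ[ℂ] Space F Q) :=
  pauliGroup p F Q ⊓ Subgroup.centralizer (𝒢 : Set (Space F Q ≃ₗ[ℂ] Space F Q))

/-- The number of tensor factors at which `c ⊗_j Z^{b_j} X^{a_j}` is not a multiple of the
identity. -/
def weight (b a : Q → F) : ℕ := {j : Q | b j ≠ 0 ∨ a j ≠ 0}.ncard

/-! ### Subsystem codes -/

/-- The center `C_P(𝒢) ∩ 𝒢` of a gauge group `𝒢`. -/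
def gaugeCenter (𝒢 : Subgroup (Space F Q ≃ₗ[ℂ] Space F Q)) :
    Subgroup (Space F Q ≃ₗ[ℂ] Space F Q) :=
  pauliCentralizer p 𝒢 ⊓ 𝒢

/-- `S` is a stabilizer group of the gauge group `𝒢`: it is the center of `𝒢` up to phases, and
contains no scalar operator except the identity. -/
structure IsStabilizerOf (𝒢 S : Subgroup (Space F Q ≃ₗ[ℂ] Space F Q)) : Prop where
  sup_phases : S ⊔ phaseGroup p = gaugeCenter p 𝒢
  inf_phases : S ⊓ phaseGroup p = ⊥

/-- The space of the states that are fixed by all elements of `S`. -/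
def codeSpace (S : Subgroup (Space F Q ≃ₗ[ℂ] Space F Q)) : Submodule ℂ (Space F Q) where
  carrier := {ψ | ∀ U ∈ S, U ψ = ψ}
  zero_mem' U _ := map_zero U
  add_mem' hψ hφ U hU := by rw [map_add, hψ U hU, hφ U hU]
  smul_mem' c ψ hψ U hU := by rw [map_smul, hψ U hU]

variable [Fintype F] [DecidableEq Q]

/-- The code space of `S` is, for the gauge group `𝒢`, the state space `C_L ⊗ C_G` of `k` logical
and `g` gauge qudits, indexed here by `Fin k ⊕ Fin g` (so that `Space F (Fin k ⊕ Fin g)` is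
`Space F (Fin k) ⊗ Space F (Fin g)` in the basis `|x⟩ ⊗ |y⟩`): up to a unitary identification of
the two spaces, the gauge operators act on the code space as the Pauli operators of the gauge
qudits, with the identity on `C_L`, and the bare logical operators, which are the elements of
`C_P(𝒢)`, act as the Pauli operators of the logical qudits, with the identity on `C_G`. In both
cases all Pauli operators of these qudits occur. -/
def Encodes (𝒢 S : Subgroup (Space F Q ≃ₗ[ℂ] Space F Q)) (k g : ℕ) : Prop :=
  ∃ Φ : Space F (Fin k ⊕ Fin g) ≃ₗᵢ[ℂ] codeSpace S,
    (∀ U ∈ 𝒢, ∃ c ∈ phases p, ∃ b a : Fin g → F, ∀ ψ,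
      U (Φ ψ) = Φ (pauli p c (Sum.elim 0 b) (Sum.elim 0 a) ψ)) ∧
    (∀ c ∈ phases p, ∀ b a : Fin g → F, ∃ U ∈ 𝒢, ∀ ψ,
      U (Φ ψ) = Φ (pauli p c (Sum.elim 0 b) (Sum.elim 0 a) ψ)) ∧
    (∀ U ∈ pauliCentralizer p 𝒢, ∃ c ∈ phases p, ∃ b a : Fin k → F, ∀ ψ,
      U (Φ ψ) = Φ (pauli p c (Sum.elim b 0) (Sum.elim a 0) ψ)) ∧
    (∀ c ∈ phases p, ∀ b a : Fin k → F, ∃ U ∈ pauliCentralizer p 𝒢, ∀ ψ,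
      U (Φ ψ) = Φ (pauli p c (Sum.elim b 0) (Sum.elim a 0) ψ))

/-- The gauge group `𝒢`, with stabilizer group `S`, defines a quantum subsystem code over `F` with
`n` physical qudits, `k` logical qudits and distance `d`. The distance is the least weight of the
dressed logical operators, which are the elements of `C_P(S) \ 𝒢`. -/
structure IsSubsystemCode (𝒢 S : Subgroup (Space F Q ≃ₗ[ℂ] Space F Q)) (n k d : ℕ) : Prop where
  gauge_le : 𝒢 ≤ pauliGroup p F Q
  stabilizer : IsStabilizerOf p 𝒢 S
  length : Fintype.card Q = n
  encodes : ∃ g : ℕ, Encodes p 𝒢 S k g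
  distance : IsLeast {w : ℕ | ∃ c ∈ phases p, ∃ b a : Q → F,
    pauli p c b a ∈ pauliCentralizer p S ∧ pauli p c b a ∉ 𝒢 ∧ weight b a = w} d

/-! ### Subsystem CSS codes -/

/-- The space spanned over `F` by the rows of a matrix. -/
def rowSpace {ρ κ : Type*} (A : Matrix ρ κ F) : Submodule F (κ → F) :=
  Submodule.span F (Set.range fun i => A i)

/-- The gauge group of the subsystem CSS code with gauge generator matrices `GX` and `GZ`. It is
generated by the phases, the `X^a` with `a` in the row space of `GX` and the `Z^b` with `b` in the
row space of `GZ`. -/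
def cssGauge {ρ σ : Type*} (GX : Matrix ρ Q F) (GZ : Matrix σ Q F) :
    Subgroup (Space F Q ≃ₗ[ℂ] Space F Q) :=
  phaseGroup p ⊔ Subgroup.closure
    (X '' (rowSpace GX : Set (Q → F)) ∪ Z p '' (rowSpace GZ : Set (Q → F)))

/-- The stabilizer group of a CSS gauge group, with the usual choice of signs: it is generated by
the operators `X^a` and `Z^b`, without phases, that lie in the center of `𝒢`. -/
def cssStabilizer (𝒢 : Subgroup (Space F Q ≃ₗ[ℂ] Space F Q)) :
    Subgroup (Space F Q ≃ₗ[ℂ] Space F Q) :=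
  Subgroup.closure ((Set.range X ∪ Set.range (Z p)) ∩ gaugeCenter p 𝒢)

end Pauli

/-! ### Simplex codes and the subsystem hypergraph product -/

section Simplex

variable {F : Type*} [Field F] {ι κ : Type*} {r : ℕ}

/-- `G` is a generator matrix of the simplex code of dimension `r` over `F`: its columns are
representatives of the points of the projective space `PG(r - 1, F)`, one for each point. -/
def IsSimplexGenerator (G : Matrix (Fin r) ι F) : Prop :=
  ∃ h : ∀ j, G.col j ≠ 0,
    Function.Bijective fun j => Projectivization.mk F (G.col j) (h j)

/-- `H` is a parity-check matrix of the linear code `C`: the code is the kernel of `H`. -/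
def IsParityCheck [Fintype ι] (H : Matrix κ ι F) (C : Submodule F (ι → F)) : Prop :=
  ∀ c : ι → F, c ∈ C ↔ H.mulVec c = 0

end Simplex

/-- The gauge group of the subsystem hypergraph product of two copies of `H`: the qudits form the
lattice `ι × ι`, and the gauge generators are `GX = H ⊗ I` and `GZ = I ⊗ H`. -/
def shpGauge (p : ℕ) [Fact p.Prime] {F : Type*} [Field F] [Fintype F] [Algebra (ZMod p) F]
    {ι κ : Type*} [Fintype ι] [DecidableEq ι] (H : Matrix κ ι F) :
    Subgroup (Space F (ι × ι) ≃ₗ[ℂ] Space F (ι × ι)) :=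
  cssGauge p (H ⊗ₖ (1 : Matrix ι ι F)) ((1 : Matrix ι ι F) ⊗ₖ H)

end Qudit

end

/-!
A group of Pauli operators that contains the phases is given by two codes: the space `B` of the
`Z` parts and the space `A` of the `X` parts. Its centralizer in the Pauli group is given by `Aᗮ`
and `Bᗮ`, its center by `B ∩ Aᗮ` and `A ∩ Bᗮ`, and the centralizer of the center by `B + Aᗮ` and
`A + Bᗮ`. If the rows of `M` represent a basis of `B + Aᗮ` modulo `B ∩ Aᗮ`, then the normalized
sums of the `|x⟩` with `x ∈ A + Bᗮ` and `M x = y` form an orthonormal basis of the code space. The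
quotient `(B + Aᗮ) / (B ∩ Aᗮ)` is the direct sum of `Aᗮ / (B ∩ Aᗮ)` and `B / (B ∩ Aᗮ)`; basis
vectors of the first summand give the logical qudits, and those of the second one the gauge qudits.

For the hypergraph product of a code `C` of dimension `k` and length `n`, these codes are
`B = Fⁿ ⊗ Cᗮ` and `A = Cᗮ ⊗ Fⁿ`. Hence `Aᗮ / (B ∩ Aᗮ) = C ⊗ (Fⁿ / Cᗮ)` has dimension `k²`. The `X`
part of a dressed logical operator is an array `y + z` such that the rows of `y` lie in `C` and the
columns of `z` in `Cᗮ`. If it is not in `A`, then some `e ∈ C` is not orthogonal to all of its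
columns, and the combination of its rows with coefficients `e` is a nonzero codeword. Since an array
with a single nonzero row attains the bound, the distance is that of `C`.

The scalar multiples of the columns of a generator matrix of the simplex code run exactly once
through the nonzero vectors, and `q ^ r - q ^ (r - 1)` of these lie outside a given hyperplane.
Therefore all nonzero codewords have weight `q ^ (r - 1)`.
-/

noncomputable section

open scoped Matrix

namespace Qudit

/-! ### Dual codes -/

section Perp

variable {F : Type*} [Field F] {Q m : Type*} [Fintype Q]

/-- The orthogonal complement of a subspace of `F^Q` for the dot product, that is, the dual of a
linear code. -/
def perp (V : Submodule F (Q → F)) : Submodule F (Q → F) :=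
  LinearMap.BilinForm.orthogonal (dotProductBilin F F) V

variable {V V' : Submodule F (Q → F)} {x : Q → F}

lemma mem_perp : x ∈ perp V ↔ ∀ v ∈ V, v ⬝ᵥ x = 0 := Iff.rfl

lemma mem_perp' : x ∈ perp V ↔ ∀ v ∈ V, x ⬝ᵥ v = 0 := by
  simp only [mem_perp, dotProduct_comm]

lemma perp_perp (V : Submodule F (Q → F)) : perp (perp V) = V := by
  have hrefl : LinearMap.IsRefl (dotProductBilin F F : LinearMap.BilinForm F (Q → F)) :=
    fun x y h => (dotProduct_comm y x).trans h
  exact LinearMap.BilinForm.orthogonal_orthogonal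
    (hrefl.nondegenerate_iff_separatingLeft.2 fun x h => dotProduct_eq_zero x h) hrefl V

lemma le_perp_comm : V ≤ perp V' ↔ V' ≤ perp V :=
  ⟨fun h v' hv' => mem_perp'.2 fun _ hv => h hv v' hv',
    fun h v hv => mem_perp'.2 fun _ hv' => h hv' v hv⟩

lemma perp_sup (V V' : Submodule F (Q → F)) : perp (V ⊔ V') = perp V ⊓ perp V' :=
  eq_of_forall_le_iff fun _ => by
    rw [le_inf_iff, le_perp_comm, sup_le_iff, le_perp_comm, le_perp_comm (V' := V')]

lemma perp_inf (V V' : Submodule F (Q → F)) : perp (V ⊓ V') = perp V ⊔ perp V' := by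
  rw [← perp_perp (perp V ⊔ perp V'), perp_sup, perp_perp, perp_perp]

lemma inf_perp_le_perp (V V' : Submodule F (Q → F)) : V' ⊓ perp V ≤ perp (V ⊓ perp V') :=
  fun _ hx v hv => hx.2 v hv.1

lemma perp_comap_funLeft {Q' : Type*} [Fintype Q'] (e : Q' ≃ Q) (V : Submodule F (Q' → F)) :
    perp (V.comap (LinearMap.funLeft F F e)) = (perp V).comap (LinearMap.funLeft F F e) := by
  ext x
  refine ⟨fun h v hv => ?_, fun h v hv => ?_⟩
  · have hv' : v ∘ e.symm ∈ V.comap (LinearMap.funLeft F F e) := by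
      simpa [LinearMap.funLeft, Function.comp_assoc] using hv
    rw [← h _ hv']
    exact (comp_equiv_symm_dotProduct v x e).symm
  · rw [← h _ hv]
    exact (comp_equiv_dotProduct_comp_equiv v x e).symm

lemma mem_perp_rowSpace (A : Matrix m Q F) : x ∈ perp (rowSpace A) ↔ A *ᵥ x = 0 := by
  have h : rowSpace A ≤ LinearMap.ker ((dotProductBilin F F).flip x) ↔ ∀ i, A i ⬝ᵥ x = 0 :=
    Submodule.span_le.trans Set.forall_mem_range
  exact h.trans funext_iff.symm

end Perp

section RowSpace

variable {F : Type*} [Field F] {Q m m' : Type*}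

lemma mem_rowSpace_iff [Fintype m] {A : Matrix m Q F} {x : Q → F} :
    x ∈ rowSpace A ↔ ∃ c, c ᵥ* A = x := by
  change x ∈ Submodule.span F (Set.range A.row) ↔ _
  rw [← range_vecMulLinear]
  rfl

lemma rowSpace_submatrix_equiv (A : Matrix m Q F) (e : m' ≃ m) :
    rowSpace (A.submatrix e id) = rowSpace A :=
  congrArg (Submodule.span F) (e.surjective.range_comp fun i => A i)

lemma rowSpace_fromRows (A : Matrix m Q F) (A' : Matrix m' Q F) :
    rowSpace (Matrix.fromRows A A') = rowSpace A ⊔ rowSpace A' := by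
  have h : (fun i => Matrix.fromRows A A' i) = Sum.elim (fun i => A i) fun i => A' i := by
    ext (i | i) j <;> rfl
  rw [rowSpace, h, Set.Sum.elim_range, Submodule.span_union]
  rfl

end RowSpace

/-! ### Bases of quotients of codes -/

section IsBasisModulo

variable {F : Type*} [Field F] {Q m m' : Type*} [Fintype m] [Fintype m']
  {M : Matrix m Q F} {M' : Matrix m' Q F} {N V V' : Submodule F (Q → F)}

/-- The rows of `M` represent a basis of the quotient `V / N`, where `N ≤ V`. For a stabilizer
code, such a matrix singles out the logical operators modulo the stabilizers. -/
structure IsBasisModulo (M : Matrix m Q F) (N V : Submodule F (Q → F)) : Prop where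
  eq_zero_of_vecMul_mem : ∀ c, c ᵥ* M ∈ N → c = 0
  sup_rowSpace : N ⊔ rowSpace M = V

namespace IsBasisModulo

lemma le (hM : IsBasisModulo M N V) : N ≤ V :=
  le_sup_left.trans_eq hM.sup_rowSpace

lemma vecMul_mem (hM : IsBasisModulo M N V) (c : m → F) : c ᵥ* M ∈ V :=
  le_sup_right.trans_eq hM.sup_rowSpace (mem_rowSpace_iff.2 ⟨c, rfl⟩)

lemma exists_sub_vecMul_mem (hM : IsBasisModulo M N V) {v : Q → F} (hv : v ∈ V) :
    ∃ c, v - c ᵥ* M ∈ N := by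
  obtain ⟨n, hn, w, hw, rfl⟩ := Submodule.mem_sup.1 (hM.sup_rowSpace ▸ hv)
  obtain ⟨c, rfl⟩ := mem_rowSpace_iff.1 hw
  exact ⟨c, by rwa [add_sub_cancel_right]⟩

lemma submatrix_equiv (hM : IsBasisModulo M N V) (e : m' ≃ m) :
    IsBasisModulo (M.submatrix e id) N V where
  eq_zero_of_vecMul_mem c hc := by
    rw [Matrix.submatrix_vecMul_equiv] at hc
    ext i
    simpa using congrFun (hM.eq_zero_of_vecMul_mem _ hc) (e i)
  sup_rowSpace := by rw [rowSpace_submatrix_equiv, hM.sup_rowSpace]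

lemma fromRows (hM : IsBasisModulo M N V) (hM' : IsBasisModulo M' N V') (h : V ⊓ V' = N) :
    IsBasisModulo (Matrix.fromRows M M') N (V ⊔ V') where
  eq_zero_of_vecMul_mem c hc := by
    rw [Matrix.vecMul_fromRows] at hc
    have hl : c ∘ Sum.inl = 0 := hM.eq_zero_of_vecMul_mem _ <| h ▸
      ⟨hM.vecMul_mem _, by simpa using sub_mem (hM'.le hc) (hM'.vecMul_mem (c ∘ Sum.inr))⟩
    rw [hl, Matrix.zero_vecMul, zero_add] at hc
    have hr : c ∘ Sum.inr = 0 := hM'.eq_zero_of_vecMul_mem _ hc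
    rw [← Sum.elim_comp_inl_inr c, hl, hr, Sum.elim_zero_zero]
  sup_rowSpace := by
    rw [rowSpace_fromRows, sup_sup_distrib_left, hM.sup_rowSpace, hM'.sup_rowSpace]

variable [Fintype Q]

lemma mem_perp_iff (hM : IsBasisModulo M N V) {x : Q → F} :
    x ∈ perp V ↔ x ∈ perp N ∧ M *ᵥ x = 0 := by
  rw [← hM.sup_rowSpace, perp_sup, Submodule.mem_inf, mem_perp_rowSpace]

/-- A vector `c` orthogonal to the image of `perp N` under `M` satisfies
`c ᵥ* M ∈ perp (perp N) = N`, hence vanishes. -/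
lemma exists_mem_perp_mulVec_eq (hM : IsBasisModulo M N V) (y : m → F) :
    ∃ x ∈ perp N, M *ᵥ x = y := by
  have hperp : perp ((perp N).map M.mulVecLin) = perp ⊤ := by
    refine le_antisymm (fun c hc => ?_) (le_perp_comm.1 (le_top.trans_eq (perp_perp _).symm))
    suffices c = 0 from this ▸ zero_mem _
    refine hM.eq_zero_of_vecMul_mem c ?_
    rw [← perp_perp N, mem_perp']
    intro x hx
    rw [← Matrix.dotProduct_mulVec]
    exact mem_perp'.1 hc _ (Submodule.mem_map_of_mem hx)
  have htop : (perp N).map M.mulVecLin = ⊤ := by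
    rw [← perp_perp ((perp N).map _), hperp, perp_perp]
  have hy : y ∈ (perp N).map M.mulVecLin := htop ▸ Submodule.mem_top
  exact hy

lemma exists_mem_perp_mulVec_eq_of_inf (hM : IsBasisModulo M (V ⊓ V') V) (y : m → F) :
    ∃ x ∈ perp V', M *ᵥ x = y := by
  obtain ⟨x, hx, rfl⟩ := hM.exists_mem_perp_mulVec_eq y
  rw [perp_inf] at hx
  obtain ⟨v, hv, v', hv', rfl⟩ := Submodule.mem_sup.1 hx
  exact ⟨v', hv', by rw [Matrix.mulVec_add, (hM.mem_perp_iff.1 hv).2, zero_add]⟩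

end IsBasisModulo

lemma exists_isBasisModulo [Finite Q] (h : N ≤ V) :
    ∃ (g : ℕ) (M : Matrix (Fin g) Q F), IsBasisModulo M N V := by
  obtain ⟨C, hC⟩ := exists_isCompl N
  let e := Module.finBasis F ↥(C ⊓ V)
  let M : Matrix _ Q F := Matrix.of fun i => (e i : Q → F)
  have hrow : rowSpace M = C ⊓ V := by
    have h := congrArg (Submodule.map (C ⊓ V).subtype) e.span_eq
    rwa [Submodule.map_span, ← Set.range_comp, Submodule.map_top, Submodule.range_subtype] at h
  refine ⟨_, M, fun c hc => ?_, ?_⟩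
  · have hcC : c ᵥ* M ∈ C := (hrow.le (mem_rowSpace_iff.2 ⟨c, rfl⟩)).1
    have hsum : ∑ i, c i • (e i : Q → F) = 0 :=
      (Matrix.vecMul_eq_sum c M).symm.trans (Submodule.disjoint_def.1 hC.disjoint _ hc hcC)
    refine funext (Fintype.linearIndependent_iff.1 e.linearIndependent c ?_)
    exact Subtype.ext (by simpa using hsum)
  · rw [hrow, ← sup_inf_assoc_of_le C h, hC.sup_eq_top, top_inf_eq]

end IsBasisModulo

/-! ### Groups of Pauli operators -/

section Pauli

variable (p : ℕ) [Fact p.Prime] {F : Type*} [Field F] [Algebra (ZMod p) F] {Q : Type*}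

lemma chr_ne_zero (α : F) : chr p α ≠ 0 := right_ne_zero_of_mul_eq_one (chr_neg_mul p α)

lemma chr_eq_one_iff (α : F) : chr p α = 1 ↔ Algebra.trace (ZMod p) F α = 0 := by
  rw [chr, ← (ZMod.stdAddChar (N := p)).map_zero_eq_one, ZMod.injective_stdAddChar.eq_iff]

lemma eq_zero_of_forall_chr_mul_eq_one [Finite F] {α : F} (h : ∀ t : F, chr p (t * α) = 1) :
    α = 0 := by
  have : Module.Finite (ZMod p) F := Module.Finite.of_finite
  refine (traceForm_nondegenerate (ZMod p) F).2 α fun t => ?_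
  rw [Algebra.traceForm_apply]
  exact (chr_eq_one_iff p _).1 (h t)

/-- The character `chr` with values in the group of units, so that it can serve as the phase of a
Pauli operator. -/
def chrUnit : AddChar F ℂˣ where
  toFun α := Units.mk0 (chr p α) (chr_ne_zero p α)
  map_zero_eq_one' := Units.ext (chr_zero p)
  map_add_eq_mul' α β := Units.ext (chr_add p α β)

@[simp] lemma val_chrUnit (α : F) : (chrUnit p α : ℂ) = chr p α := rfl

lemma chrUnit_mem_phases (α : F) : chrUnit p α ∈ phases p := by
  obtain ⟨u, hu, hu'⟩ := exists_phase_chr p α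
  rwa [show chrUnit p α = u from Units.ext hu'.symm]

variable [Fintype Q]

lemma mem_perp_iff_forall_chr [Finite F] (V : Submodule F (Q → F)) (x : Q → F) :
    x ∈ perp V ↔ ∀ v ∈ V, chr p (v ⬝ᵥ x) = 1 := by
  refine ⟨fun h v hv => by rw [mem_perp.1 h v hv, chr_zero],
    fun h => mem_perp.2 fun v hv => eq_zero_of_forall_chr_mul_eq_one p fun t => ?_⟩
  rw [← smul_eq_mul, ← smul_dotProduct]
  exact h _ (V.smul_mem t hv)

lemma pauli_one_zero_left (a : Q → F) : pauli p 1 0 a = X a := by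
  ext ψ x; simp [pauli_apply, chr_zero]

lemma pauli_one_zero_right (b : Q → F) : pauli p 1 b 0 = Z p b := by
  ext ψ x; simp [pauli_apply]

lemma pauli_zero_zero (c : ℂˣ) : pauli p c (0 : Q → F) 0 = phase c := by
  ext ψ x; simp [pauli_apply, chr_zero]

lemma pauli_one_zero_zero : pauli p 1 (0 : Q → F) 0 = 1 := by
  ext ψ x; simp [pauli_apply, chr_zero]

lemma pauli_mul (c c' : ℂˣ) (b a b' a' : Q → F) :
    pauli p c b a * pauli p c' b' a' =
      pauli p (c * c' * chrUnit p (-(b' ⬝ᵥ a))) (b + b') (a + a') := by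
  ext ψ x
  have h : chr p (b' ⬝ᵥ (x - a)) = chr p (b' ⬝ᵥ x) * chr p (-(b' ⬝ᵥ a)) := by
    rw [← chr_add, dotProduct_sub, sub_eq_add_neg]
  simp only [LinearEquiv.mul_apply, pauli_apply, h, add_dotProduct, chr_add, Units.val_mul,
    val_chrUnit, sub_add_eq_sub_sub]
  ring

lemma pauli_inv (c : ℂˣ) (b a : Q → F) :
    (pauli p c b a)⁻¹ = pauli p (c⁻¹ * chrUnit p (-(b ⬝ᵥ a))) (-b) (-a) := by
  rw [inv_eq_iff_mul_eq_one, pauli_mul, add_neg_cancel, add_neg_cancel, neg_dotProduct, neg_neg,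
    AddChar.map_neg_eq_inv, mul_inv_cancel_left, inv_mul_cancel, pauli_one_zero_zero]

lemma pauli_inj [Finite F] {c c' : ℂˣ} {b a b' a' : Q → F} :
    pauli p c b a = pauli p c' b' a' ↔ c = c' ∧ b = b' ∧ a = a' := by
  classical
  refine ⟨fun h => ?_, by rintro ⟨rfl, rfl, rfl⟩; rfl⟩
  have hket (y x : Q → F) : (c : ℂ) * (chr p (b ⬝ᵥ x) * if x - a = y then 1 else 0) =
      c' * (chr p (b' ⬝ᵥ x) * if x - a' = y then 1 else 0) :=
    congrFun (congrArg WithLp.ofLp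
      (LinearEquiv.congr_fun h (WithLp.toLp 2 fun x => if x = y then 1 else 0))) x
  obtain rfl : a = a' := by
    by_contra hne
    simpa [sub_eq_zero, hne, chr_ne_zero] using hket 0 a
  have hchr (x : Q → F) : (c : ℂ) * chr p (b ⬝ᵥ x) = c' * chr p (b' ⬝ᵥ x) := by
    simpa using hket (x - a) x
  obtain rfl : c = c' := Units.ext (by simpa [chr_zero] using hchr 0)
  refine ⟨rfl, sub_eq_zero.1 <| dotProduct_eq_zero _ fun w =>
    eq_zero_of_forall_chr_mul_eq_one p fun t => ?_, rfl⟩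
  rw [← smul_eq_mul, ← dotProduct_smul, sub_dotProduct, sub_eq_neg_add, chr_add,
    mul_left_cancel₀ c.ne_zero (hchr _), chr_neg_mul]

lemma commute_pauli_iff [Finite F] (c c' : ℂˣ) (b a b' a' : Q → F) :
    Commute (pauli p c b a) (pauli p c' b' a') ↔ chr p (b' ⬝ᵥ a) = chr p (b ⬝ᵥ a') := by
  rw [commute_iff_eq, pauli_mul, pauli_mul, pauli_inj, mul_comm c', mul_right_inj, add_comm b',
    add_comm a', and_iff_left ⟨rfl, rfl⟩, AddChar.map_neg_eq_inv, AddChar.map_neg_eq_inv, inv_inj,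
    Units.ext_iff, val_chrUnit, val_chrUnit]

/-- The group of the Pauli operators `c Z^b X^a` with `b ∈ B`, `a ∈ A` and `c` an arbitrary phase:
the gauge groups of the subsystem CSS codes, and their centralizers. -/
def pauliSubgroup (B A : Submodule F (Q → F)) : Subgroup (Space F Q ≃ₗ[ℂ] Space F Q) where
  carrier := {U | ∃ c ∈ phases p, ∃ b ∈ B, ∃ a ∈ A, U = pauli p c b a}
  one_mem' := ⟨1, one_mem _, 0, zero_mem _, 0, zero_mem _, (pauli_one_zero_zero p).symm⟩
  mul_mem' := by
    rintro _ _ ⟨c, hc, b, hb, a, ha, rfl⟩ ⟨c', hc', b', hb', a', ha', rfl⟩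
    exact ⟨_, mul_mem (mul_mem hc hc') (chrUnit_mem_phases p _), _, add_mem hb hb', _,
      add_mem ha ha', pauli_mul p ..⟩
  inv_mem' := by
    rintro _ ⟨c, hc, b, hb, a, ha, rfl⟩
    exact ⟨_, mul_mem (inv_mem hc) (chrUnit_mem_phases p _), _, neg_mem hb, _, neg_mem ha,
      pauli_inv p ..⟩

variable {B A B' A' : Submodule F (Q → F)}

lemma pauliSubgroup_le_pauliGroup : pauliSubgroup p B A ≤ pauliGroup p F Q := by
  rintro _ ⟨c, hc, b, -, a, -, rfl⟩
  exact ⟨c, hc, b, a, rfl⟩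

lemma cssGauge_eq_pauliSubgroup {ρ σ : Type*} (GX : Matrix ρ Q F) (GZ : Matrix σ Q F) :
    cssGauge p GX GZ = pauliSubgroup p (rowSpace GZ) (rowSpace GX) := by
  refine le_antisymm (sup_le ?_ ((Subgroup.closure_le _).2 ?_)) ?_
  · rintro _ ⟨c, hc, rfl⟩
    exact ⟨c, hc, 0, zero_mem _, 0, zero_mem _, (pauli_zero_zero p c).symm⟩
  · rintro _ (⟨a, ha, rfl⟩ | ⟨b, hb, rfl⟩)
    · exact ⟨1, one_mem _, 0, zero_mem _, a, ha, (pauli_one_zero_left p a).symm⟩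
    · exact ⟨1, one_mem _, b, hb, 0, zero_mem _, (pauli_one_zero_right p b).symm⟩
  · rintro _ ⟨c, hc, b, hb, a, ha, rfl⟩
    rw [pauli, mul_assoc]
    exact Subgroup.mul_mem_sup ⟨c, hc, rfl⟩ (mul_mem
      (Subgroup.subset_closure (Or.inr ⟨b, hb, rfl⟩))
      (Subgroup.subset_closure (Or.inl ⟨a, ha, rfl⟩)))

/-- The group of the Pauli operators `Z^b X^a` with `b ∈ B` and `a ∈ A`, without phases. It is
closed under products when `A` and `B` are orthogonal. These are the stabilizer groups of the
subsystem CSS codes. -/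
def stabilizerGroup (B A : Submodule F (Q → F)) (h : A ≤ perp B) :
    Subgroup (Space F Q ≃ₗ[ℂ] Space F Q) where
  carrier := {U | ∃ b ∈ B, ∃ a ∈ A, U = pauli p 1 b a}
  one_mem' := ⟨0, zero_mem _, 0, zero_mem _, (pauli_one_zero_zero p).symm⟩
  mul_mem' := by
    rintro _ _ ⟨b, hb, a, ha, rfl⟩ ⟨b', hb', a', ha', rfl⟩
    refine ⟨b + b', add_mem hb hb', a + a', add_mem ha ha', ?_⟩
    rw [pauli_mul, mem_perp.1 (h ha) b' hb', neg_zero, AddChar.map_zero_eq_one, mul_one, mul_one]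
  inv_mem' := by
    rintro _ ⟨b, hb, a, ha, rfl⟩
    refine ⟨-b, neg_mem hb, -a, neg_mem ha, ?_⟩
    rw [pauli_inv, mem_perp.1 (h ha) b hb, neg_zero, AddChar.map_zero_eq_one, inv_one, mul_one]

variable (h : A ≤ perp B)

lemma X_mem_stabilizerGroup {a : Q → F} (ha : a ∈ A) : X a ∈ stabilizerGroup p B A h :=
  ⟨0, zero_mem _, a, ha, (pauli_one_zero_left p a).symm⟩

lemma Z_mem_stabilizerGroup {b : Q → F} (hb : b ∈ B) : Z p b ∈ stabilizerGroup p B A h :=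
  ⟨b, hb, 0, zero_mem _, (pauli_one_zero_right p b).symm⟩

lemma stabilizerGroup_le_pauliSubgroup : stabilizerGroup p B A h ≤ pauliSubgroup p B A := by
  rintro _ ⟨b, hb, a, ha, rfl⟩
  exact ⟨1, one_mem _, b, hb, a, ha, rfl⟩

lemma stabilizerGroup_sup_phaseGroup :
    stabilizerGroup p B A h ⊔ phaseGroup p = pauliSubgroup p B A := by
  refine le_antisymm (sup_le (stabilizerGroup_le_pauliSubgroup p h) ?_) ?_
  · rintro _ ⟨c, hc, rfl⟩
    exact ⟨c, hc, 0, zero_mem _, 0, zero_mem _, (pauli_zero_zero p c).symm⟩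
  · rintro _ ⟨c, hc, b, hb, a, ha, rfl⟩
    have hmul : pauli p c b a = pauli p 1 b a * phase c := by
      rw [← pauli_zero_zero p, pauli_mul]
      simp
    rw [hmul]
    exact Subgroup.mul_mem_sup ⟨b, hb, a, ha, rfl⟩ ⟨c, hc, rfl⟩

variable [Finite F]

lemma stabilizerGroup_inf_phaseGroup : stabilizerGroup p B A h ⊓ phaseGroup p = ⊥ := by
  rw [eq_bot_iff]
  rintro _ ⟨⟨b, -, a, -, hU⟩, c, -, rfl⟩
  rw [← pauli_zero_zero p] at hU ⊢
  rw [((pauli_inj p).1 hU).1, pauli_one_zero_zero]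
  exact one_mem _

lemma pauli_mem_pauliSubgroup {c : ℂˣ} {b a : Q → F} :
    pauli p c b a ∈ pauliSubgroup p B A ↔ c ∈ phases p ∧ b ∈ B ∧ a ∈ A := by
  constructor
  · rintro ⟨c', hc, b', hb, a', ha, h⟩
    obtain ⟨rfl, rfl, rfl⟩ := (pauli_inj p).1 h
    exact ⟨hc, hb, ha⟩
  · rintro ⟨hc, hb, ha⟩
    exact ⟨c, hc, b, hb, a, ha, rfl⟩

lemma X_mem_pauliSubgroup {a : Q → F} : X a ∈ pauliSubgroup p B A ↔ a ∈ A := by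
  simp [← pauli_one_zero_left p, pauli_mem_pauliSubgroup]

lemma Z_mem_pauliSubgroup {b : Q → F} : Z p b ∈ pauliSubgroup p B A ↔ b ∈ B := by
  simp [← pauli_one_zero_right p, pauli_mem_pauliSubgroup]

variable (B A B' A') in
lemma pauliSubgroup_inf :
    pauliSubgroup p B A ⊓ pauliSubgroup p B' A' = pauliSubgroup p (B ⊓ B') (A ⊓ A') := by
  refine le_antisymm ?_ ?_
  · rintro _ ⟨⟨c, hc, b, hb, a, ha, rfl⟩, h⟩
    obtain ⟨-, hb', ha'⟩ := (pauli_mem_pauliSubgroup p).1 h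
    exact ⟨c, hc, b, ⟨hb, hb'⟩, a, ⟨ha, ha'⟩, rfl⟩
  · rintro _ ⟨c, hc, b, hb, a, ha, rfl⟩
    exact ⟨⟨c, hc, b, hb.1, a, ha.1, rfl⟩, ⟨c, hc, b, hb.2, a, ha.2, rfl⟩⟩

lemma pauliCentralizer_eq_pauliSubgroup {T : Subgroup (Space F Q ≃ₗ[ℂ] Space F Q)}
    (hT : T ≤ pauliSubgroup p B A) (hX : ∀ a ∈ A, X a ∈ T) (hZ : ∀ b ∈ B, Z p b ∈ T) :
    pauliCentralizer p T = pauliSubgroup p (perp A) (perp B) := by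
  refine le_antisymm ?_ ?_
  · rintro _ ⟨⟨c, hc, b, a, rfl⟩, hcomm⟩
    refine ⟨c, hc, b, (mem_perp_iff_forall_chr p _ _).2 fun v hv => ?_,
      a, (mem_perp_iff_forall_chr p _ _).2 fun v hv => ?_, rfl⟩
    · have hv' := Subgroup.mem_centralizer_iff.1 hcomm _ (hX v hv)
      rw [← pauli_one_zero_left p, ← commute_iff_eq, commute_pauli_iff, zero_dotProduct,
        chr_zero] at hv'
      rw [dotProduct_comm, hv']
    · have hv' := Subgroup.mem_centralizer_iff.1 hcomm _ (hZ v hv)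
      rw [← pauli_one_zero_right p, ← commute_iff_eq, commute_pauli_iff, dotProduct_zero,
        chr_zero] at hv'
      exact hv'.symm
  · rintro _ ⟨c, hc, b, hb, a, ha, rfl⟩
    refine ⟨⟨c, hc, b, a, rfl⟩, Subgroup.mem_centralizer_iff.2 fun V hV => ?_⟩
    obtain ⟨c', -, b', hb', a', ha', rfl⟩ := hT hV
    refine (commute_pauli_iff p ..).2 ?_
    rw [mem_perp'.1 hb a' ha', mem_perp.1 ha b' hb']

variable (B A) in
lemma pauliCentralizer_pauliSubgroup :
    pauliCentralizer p (pauliSubgroup p B A) = pauliSubgroup p (perp A) (perp B) :=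
  pauliCentralizer_eq_pauliSubgroup p le_rfl (fun _ => (X_mem_pauliSubgroup p).2)
    fun _ => (Z_mem_pauliSubgroup p).2

lemma pauliCentralizer_stabilizerGroup :
    pauliCentralizer p (stabilizerGroup p B A h) = pauliSubgroup p (perp A) (perp B) :=
  pauliCentralizer_eq_pauliSubgroup p (stabilizerGroup_le_pauliSubgroup p h)
    (fun _ => X_mem_stabilizerGroup p h) fun _ => Z_mem_stabilizerGroup p h

variable (B A) in
lemma gaugeCenter_pauliSubgroup :
    gaugeCenter p (pauliSubgroup p B A) = pauliSubgroup p (B ⊓ perp A) (A ⊓ perp B) := by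
  rw [gaugeCenter, pauliCentralizer_pauliSubgroup, pauliSubgroup_inf, inf_comm B, inf_comm A]

variable (B A) in
lemma cssStabilizer_pauliSubgroup :
    cssStabilizer p (pauliSubgroup p B A) =
      stabilizerGroup p (B ⊓ perp A) (A ⊓ perp B) (inf_perp_le_perp B A) := by
  rw [cssStabilizer, gaugeCenter_pauliSubgroup]
  refine le_antisymm ((Subgroup.closure_le _).2 ?_) ?_
  · rintro _ ⟨⟨a, rfl⟩ | ⟨b, rfl⟩, hU⟩
    · exact X_mem_stabilizerGroup p _ ((X_mem_pauliSubgroup p).1 hU)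
    · exact Z_mem_stabilizerGroup p _ ((Z_mem_pauliSubgroup p).1 hU)
  · rintro _ ⟨b, hb, a, ha, rfl⟩
    have hmul : pauli p 1 b a = Z p b * X a := by
      rw [← pauli_one_zero_left p, ← pauli_one_zero_right p, pauli_mul]
      simp
    rw [hmul]
    exact mul_mem
      (Subgroup.subset_closure ⟨Or.inr ⟨b, rfl⟩, (Z_mem_pauliSubgroup p).2 hb⟩)
      (Subgroup.subset_closure ⟨Or.inl ⟨a, rfl⟩, (X_mem_pauliSubgroup p).2 ha⟩)

variable (B A) in
lemma isStabilizerOf_cssStabilizer :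
    IsStabilizerOf p (pauliSubgroup p B A) (cssStabilizer p (pauliSubgroup p B A)) := by
  rw [cssStabilizer_pauliSubgroup]
  exact ⟨(stabilizerGroup_sup_phaseGroup p _).trans (gaugeCenter_pauliSubgroup p B A).symm,
    stabilizerGroup_inf_phaseGroup p _⟩

end Pauli

/-! ### Encoding of the logical and gauge qudits -/

section Encoding

variable {F : Type*} [Field F] {Q m m' : Type*} [Fintype Q]
  {A B V V' : Submodule F (Q → F)} {M : Matrix m Q F}

open scoped Classical in
/-- The linear map that sends the basis state `|y⟩` to the normalized sum of the states `|x⟩` with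
`x ∈ perp B` and `M *ᵥ x = y`. When the rows of `M` represent a basis of `perp A` modulo `B`, these
`x` form a coset of `A`, and `|y⟩` is encoded into the code space of `stabilizerGroup p B A`. -/
def encoder (B A : Submodule F (Q → F)) (M : Matrix m Q F) : Space F m →ₗ[ℂ] Space F Q where
  toFun ψ := WithLp.toLp 2 fun x =>
    if x ∈ perp B then ((√(Nat.card A) : ℝ) : ℂ)⁻¹ * ψ (M *ᵥ x) else 0
  map_add' ψ φ := by ext x; by_cases h : x ∈ perp B <;> simp [h, mul_add]
  map_smul' c ψ := by ext x; by_cases h : x ∈ perp B <;> simp [h, mul_left_comm]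

lemma encoder_apply_of_mem (ψ : Space F m) {x : Q → F} (hx : x ∈ perp B) :
    encoder B A M ψ x = ((√(Nat.card A) : ℝ) : ℂ)⁻¹ * ψ (M *ᵥ x) := if_pos hx

lemma encoder_apply_of_notMem (ψ : Space F m) {x : Q → F} (hx : x ∉ perp B) :
    encoder B A M ψ x = 0 := if_neg hx

section Pauli

variable (p : ℕ) [Fact p.Prime] [Algebra (ZMod p) F]

lemma mem_codeSpace_stabilizerGroup [Finite F] (h : A ≤ perp B) (ψ : Space F Q) :
    ψ ∈ codeSpace (stabilizerGroup p B A h) ↔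
      (∀ x ∉ perp B, ψ x = 0) ∧ ∀ a ∈ A, ∀ x, ψ (x - a) = ψ x := by
  refine ⟨fun hψ => ⟨fun x hx => ?_, fun a ha x => ?_⟩, ?_⟩
  · rw [mem_perp_iff_forall_chr p] at hx
    push Not at hx
    obtain ⟨b, hb, hx⟩ := hx
    have hfix : chr p (b ⬝ᵥ x) * ψ x = ψ x :=
      congrArg (fun φ : Space F Q => φ x) (hψ _ (Z_mem_stabilizerGroup p h hb))
    by_contra hne
    exact hx ((mul_eq_right₀ hne).1 hfix)
  · exact congrArg (fun φ : Space F Q => φ x) (hψ _ (X_mem_stabilizerGroup p h ha))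
  · rintro ⟨hsupp, htrans⟩ _ ⟨b, hb, a, ha, rfl⟩
    ext x
    rw [pauli_apply, htrans a ha, Units.val_one, one_mul]
    by_cases hx : x ∈ perp B
    · rw [mem_perp.1 hx b hb, chr_zero, one_mul]
    · rw [hsupp x hx, mul_zero]

lemma pauli_encoder [Fintype m] {b a : Q → F} {c : m → F} (hb : b - c ᵥ* M ∈ B)
    (ha : a ∈ perp B) (t : ℂˣ) (ψ : Space F m) :
    pauli p t b a (encoder B A M ψ) = encoder B A M (pauli p t c (M *ᵥ a) ψ) := by
  ext x
  rw [pauli_apply]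
  by_cases hx : x ∈ perp B
  · have hbx : b ⬝ᵥ x = c ⬝ᵥ (M *ᵥ x) := by
      rw [Matrix.dotProduct_mulVec, ← sub_eq_zero, ← sub_dotProduct]
      exact mem_perp.1 hx _ hb
    rw [encoder_apply_of_mem _ (sub_mem hx ha), encoder_apply_of_mem _ hx, pauli_apply, hbx,
      Matrix.mulVec_sub]
    ring
  · have hxa : x - a ∉ perp B := fun h => hx (by simpa using add_mem h ha)
    rw [encoder_apply_of_notMem _ hxa, encoder_apply_of_notMem _ hx, mul_zero, mul_zero]

/-- The map `j` stands for the extension by zero from the encoded qudits that correspond to the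
rows of `L` to all encoded qudits. -/
lemma pauliSubgroup_encoder [Fintype m] [Fintype m'] (hB : V ⊓ V' = B)
    {L : Matrix m' Q F} (hL : IsBasisModulo L B V) {j : (m' → F) → m → F}
    (hj : ∀ c, j c ᵥ* M = c ᵥ* L) (hj' : ∀ a ∈ perp V', M *ᵥ a = j (L *ᵥ a)) :
    (∀ U ∈ pauliSubgroup p V (perp V'), ∃ t ∈ phases p, ∃ b a : m' → F, ∀ ψ,
      U (encoder B A M ψ) = encoder B A M (pauli p t (j b) (j a) ψ)) ∧
    (∀ t ∈ phases p, ∀ b a : m' → F, ∃ U ∈ pauliSubgroup p V (perp V'), ∀ ψ,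
      U (encoder B A M ψ) = encoder B A M (pauli p t (j b) (j a) ψ)) := by
  subst hB
  have hperp : perp V' ≤ perp (V ⊓ V') := (perp_inf V V').symm ▸ le_sup_right
  constructor
  · rintro _ ⟨t, ht, b, hb, a, ha, rfl⟩
    obtain ⟨c, hc⟩ := hL.exists_sub_vecMul_mem hb
    refine ⟨t, ht, c, L *ᵥ a, fun ψ => ?_⟩
    rw [← hj' a ha]
    exact pauli_encoder p (by rwa [hj]) (hperp ha) t ψ
  · intro t ht c α
    obtain ⟨a, ha, rfl⟩ := hL.exists_mem_perp_mulVec_eq_of_inf α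
    refine ⟨_, ⟨t, ht, c ᵥ* L, hL.vecMul_mem c, a, ha, rfl⟩, fun ψ => ?_⟩
    rw [← hj' a ha]
    exact pauli_encoder p (by simp only [hj, sub_self, zero_mem]) (hperp ha) t ψ

end Pauli

namespace IsBasisModulo

variable [Fintype m] (hM : IsBasisModulo M B (perp A))

include hM

lemma mem_iff_of_perp {x : Q → F} : x ∈ A ↔ x ∈ perp B ∧ M *ᵥ x = 0 := by
  rw [← hM.mem_perp_iff, perp_perp]

lemma le_perp : A ≤ perp B := fun _ hx => (hM.mem_iff_of_perp.1 hx).1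

lemma card_fibre_mulVec (y : m → F) :
    Nat.card {x // x ∈ perp B ∧ M *ᵥ x = y} = Nat.card A := by
  obtain ⟨x₀, hx₀, rfl⟩ := hM.exists_mem_perp_mulVec_eq y
  refine (Nat.card_congr ((Equiv.addRight x₀).subtypeEquiv fun x => ?_)).symm
  rw [hM.mem_iff_of_perp, Equiv.coe_addRight, Matrix.mulVec_add, add_eq_right,
    Submodule.add_mem_iff_left _ hx₀]

lemma norm_encoder [Fintype F] [DecidableEq Q] [DecidableEq m] (ψ : Space F m) :
    ‖encoder B A M ψ‖ = ‖ψ‖ := by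
  classical
  have hamp (x : Q → F) : ‖encoder B A M ψ x‖ ^ 2 =
      if x ∈ perp B then (Nat.card A : ℝ)⁻¹ * ‖ψ (M *ᵥ x)‖ ^ 2 else 0 := by
    split_ifs with hx
    · rw [encoder_apply_of_mem ψ hx, norm_mul, mul_pow, norm_inv, Complex.norm_real,
        Real.norm_of_nonneg (Real.sqrt_nonneg _), inv_pow, Real.sq_sqrt (Nat.cast_nonneg _)]
    · rw [encoder_apply_of_notMem ψ hx, norm_zero, zero_pow two_ne_zero]
  rw [EuclideanSpace.norm_eq, EuclideanSpace.norm_eq]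
  congr 1
  simp only [hamp]
  rw [← Finset.sum_filter, ← Finset.sum_fiberwise _ (M *ᵥ ·)]
  refine Finset.sum_congr rfl fun y _ => ?_
  have hcard : (({x | x ∈ perp B} : Finset (Q → F)).filter (M *ᵥ · = y)).card = Nat.card A := by
    rw [← hM.card_fibre_mulVec y, Finset.filter_filter, Nat.card_eq_fintype_card,
      Fintype.card_subtype]
  rw [Finset.sum_congr rfl (g := fun _ => (Nat.card A : ℝ)⁻¹ * ‖ψ y‖ ^ 2)
    fun x hx => by rw [(Finset.mem_filter.1 hx).2], Finset.sum_const, hcard, nsmul_eq_mul,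
    mul_inv_cancel_left₀ (Nat.cast_ne_zero.2 Nat.card_pos.ne')]

variable (p : ℕ) [Fact p.Prime] [Algebra (ZMod p) F]

lemma encoder_mem_codeSpace [Finite F] (ψ : Space F m) :
    encoder B A M ψ ∈ codeSpace (stabilizerGroup p B A hM.le_perp) := by
  refine (mem_codeSpace_stabilizerGroup p _ _).2
    ⟨fun x hx => encoder_apply_of_notMem ψ hx, fun a ha x => ?_⟩
  obtain ⟨haB, haM⟩ := hM.mem_iff_of_perp.1 ha
  by_cases hx : x ∈ perp B
  · rw [encoder_apply_of_mem ψ hx, encoder_apply_of_mem ψ (sub_mem hx haB), Matrix.mulVec_sub,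
      haM, sub_zero]
  · rw [encoder_apply_of_notMem ψ hx,
      encoder_apply_of_notMem ψ ((Submodule.sub_mem_iff_left _ haB).not.2 hx)]

lemma exists_encoder_eq [Finite F] {φ : Space F Q}
    (hφ : φ ∈ codeSpace (stabilizerGroup p B A hM.le_perp)) : ∃ ψ, encoder B A M ψ = φ := by
  obtain ⟨hsupp, htrans⟩ := (mem_codeSpace_stabilizerGroup p _ _).1 hφ
  choose f hfB hfM using hM.exists_mem_perp_mulVec_eq
  refine ⟨WithLp.toLp 2 fun y => (√(Nat.card A) : ℝ) * φ (f y), ?_⟩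
  ext x
  by_cases hx : x ∈ perp B
  · have hA : x - f (M *ᵥ x) ∈ A :=
      hM.mem_iff_of_perp.2 ⟨sub_mem hx (hfB _), by rw [Matrix.mulVec_sub, hfM, sub_self]⟩
    have hcard : ((√(Nat.card A) : ℝ) : ℂ) ≠ 0 :=
      Complex.ofReal_ne_zero.2 (Real.sqrt_ne_zero'.2 (Nat.cast_pos.2 Nat.card_pos))
    rw [encoder_apply_of_mem _ hx, inv_mul_cancel_left₀ hcard]
    simpa using htrans _ hA x
  · rw [encoder_apply_of_notMem _ hx, hsupp x hx]

/-- The encoder as a unitary isomorphism onto the code space. -/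
def codeEquiv [Fintype F] [DecidableEq Q] [DecidableEq m] :
    Space F m ≃ₗᵢ[ℂ] codeSpace (stabilizerGroup p B A hM.le_perp) :=
  .ofSurjective
    { toLinearMap := (encoder B A M).codRestrict _ (hM.encoder_mem_codeSpace p)
      norm_map' := hM.norm_encoder }
    fun φ => (hM.exists_encoder_eq p φ.2).imp fun _ => Subtype.ext

end IsBasisModulo

lemma exists_encodes_pauliSubgroup [Fintype F] [DecidableEq Q] (p : ℕ) [Fact p.Prime]
    [Algebra (ZMod p) F] {k : ℕ} {L : Matrix (Fin k) Q F}
    (hL : IsBasisModulo L (B ⊓ perp A) (perp A)) :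
    ∃ g, Encodes p (pauliSubgroup p B A) (cssStabilizer p (pauliSubgroup p B A)) k g := by
  obtain ⟨g, K, hK⟩ := exists_isBasisModulo (inf_le_left : B ⊓ perp A ≤ B)
  have hinf : perp A ⊓ B = B ⊓ perp A := inf_comm ..
  have hM : IsBasisModulo (Matrix.fromRows L K) (B ⊓ perp A) (perp (A ⊓ perp B)) := by
    rw [perp_inf, perp_perp]
    exact hL.fromRows hK hinf
  have hlogical := pauliSubgroup_encoder (M := Matrix.fromRows L K) (A := A ⊓ perp B) p hinf hL
    (j := (Sum.elim · 0)) (fun c => by simp [Matrix.vecMul_fromRows]) fun a ha => by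
      rw [Matrix.fromRows_mulVec, (hK.mem_perp_iff.1 ha).2]
  have hgauge := pauliSubgroup_encoder (M := Matrix.fromRows L K) (A := A ⊓ perp B) p rfl hK
    (j := Sum.elim 0) (fun c => by simp [Matrix.vecMul_fromRows]) fun a ha => by
      rw [Matrix.fromRows_mulVec, (hL.mem_perp_iff.1 ha).2]
  rw [perp_perp] at hgauge
  rw [cssStabilizer_pauliSubgroup]
  refine ⟨g, hM.codeEquiv p, hgauge.1, hgauge.2, ?_⟩
  rw [pauliCentralizer_pauliSubgroup]
  exact hlogical

end Encoding

/-! ### Product codes -/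

section ProductCode

variable {F : Type*} [Field F] {ι κ m : Type*}

variable (ι) in
/-- The space of the `ι × κ` arrays all of whose rows lie in `C`, that is, `F^ι ⊗ C`. -/
def rowsIn (C : Submodule F (κ → F)) : Submodule F (ι × κ → F) :=
  ⨅ i, C.comap (LinearMap.funLeft F F (Prod.mk i))

variable (κ) in
/-- The space of the `ι × κ` arrays all of whose columns lie in `C`, that is, `C ⊗ F^κ`. -/
def colsIn (C : Submodule F (ι → F)) : Submodule F (ι × κ → F) :=
  (rowsIn κ C).comap (LinearMap.funLeft F F (Equiv.prodComm κ ι))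

lemma mem_rowsIn {C : Submodule F (κ → F)} {x : ι × κ → F} :
    x ∈ rowsIn ι C ↔ ∀ i, (fun j => x (i, j)) ∈ C :=
  Submodule.mem_iInf _

lemma mem_colsIn {C : Submodule F (ι → F)} {x : ι × κ → F} :
    x ∈ colsIn κ C ↔ ∀ j, (fun i => x (i, j)) ∈ C :=
  mem_rowsIn (x := x ∘ Equiv.prodComm κ ι)

section SingleRow

variable [DecidableEq ι] {C : Submodule F (κ → F)} {c : κ → F}

/-- The `ι × κ` array whose row `i` is `c` and whose other rows vanish. -/
def singleRow (i : ι) (c : κ → F) : ι × κ → F :=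
  Function.uncurry (Pi.single i c)

lemma singleRow_mem_rowsIn (i : ι) (hc : c ∈ C) : singleRow i c ∈ rowsIn ι C := by
  refine mem_rowsIn.2 fun i' => ?_
  change (Pi.single i c : ι → κ → F) i' ∈ C
  obtain rfl | hi := eq_or_ne i' i
  · rwa [Pi.single_eq_same]
  · rw [Pi.single_eq_of_ne hi]
    exact zero_mem C

lemma singleRow_dotProduct [Fintype ι] [Fintype κ] (i : ι) (c : κ → F) (x : ι × κ → F) :
    singleRow i c ⬝ᵥ x = c ⬝ᵥ fun j => x (i, j) := by
  rw [dotProduct, Fintype.sum_prod_type, Finset.sum_eq_single_of_mem i (Finset.mem_univ i)]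
  · simp only [singleRow, Function.uncurry_apply_pair, Pi.single_eq_same, dotProduct]
  · intro i' _ hi
    simp only [singleRow, Function.uncurry_apply_pair, Pi.single_eq_of_ne hi, Pi.zero_apply,
      zero_mul, Finset.sum_const_zero]

lemma support_singleRow (i : ι) (c : κ → F) :
    Function.support (singleRow i c) = Prod.mk i '' Function.support c := by
  ext ⟨i', j⟩
  obtain rfl | hi := eq_or_ne i' i
  · simp [singleRow]
  · simp [singleRow, hi, hi.symm]

end SingleRow

lemma perp_rowsIn [Fintype ι] [Fintype κ] (C : Submodule F (κ → F)) :
    perp (rowsIn ι C) = rowsIn ι (perp C) := by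
  classical
  ext x
  refine ⟨fun hx => mem_rowsIn.2 fun i c hc => ?_, fun hx v hv => ?_⟩
  · exact (singleRow_dotProduct i c x).symm.trans (hx _ (singleRow_mem_rowsIn i hc))
  · exact (Fintype.sum_prod_type _).trans
      (Finset.sum_eq_zero fun i _ => mem_rowsIn.1 hx i _ (mem_rowsIn.1 hv i))

lemma perp_colsIn [Fintype ι] [Fintype κ] (C : Submodule F (ι → F)) :
    perp (colsIn κ C) = colsIn κ (perp C) := by
  rw [colsIn, perp_comap_funLeft, perp_rowsIn, colsIn]

lemma one_kronecker_mulVec [Fintype ι] [DecidableEq ι] [Fintype κ] (A : Matrix m κ F)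
    (x : ι × κ → F) (i : ι) (k : m) :
    (((1 : Matrix ι ι F) ⊗ₖ A) *ᵥ x) (i, k) = (A *ᵥ fun j => x (i, j)) k := by
  simp [Matrix.mulVec, dotProduct, Fintype.sum_prod_type, Matrix.one_apply, ite_mul,
    Finset.sum_ite_irrel]

lemma kronecker_one_mulVec [Fintype ι] [Fintype κ] [DecidableEq κ] (A : Matrix m ι F)
    (x : ι × κ → F) (k : m) (j : κ) :
    ((A ⊗ₖ (1 : Matrix κ κ F)) *ᵥ x) (k, j) = (A *ᵥ fun i => x (i, j)) k := by
  simp [Matrix.mulVec, dotProduct, Fintype.sum_prod_type, Matrix.one_apply]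

lemma rowSpace_one_kronecker [Finite ι] [DecidableEq ι] [Finite κ] (A : Matrix m κ F) :
    rowSpace ((1 : Matrix ι ι F) ⊗ₖ A) = rowsIn ι (rowSpace A) := by
  cases nonempty_fintype ι
  cases nonempty_fintype κ
  rw [← perp_perp (rowSpace _), ← perp_perp (rowSpace A), ← perp_rowsIn]
  congr 1
  ext x
  simp only [mem_perp_rowSpace, mem_rowsIn, funext_iff, Prod.forall, one_kronecker_mulVec,
    Pi.zero_apply]

lemma rowSpace_kronecker_one [Finite ι] [Finite κ] [DecidableEq κ] (A : Matrix m ι F) :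
    rowSpace (A ⊗ₖ (1 : Matrix κ κ F)) = colsIn κ (rowSpace A) := by
  cases nonempty_fintype ι
  cases nonempty_fintype κ
  rw [← perp_perp (rowSpace _), ← perp_perp (rowSpace A), ← perp_colsIn]
  congr 1
  ext x
  simp only [mem_perp_rowSpace, mem_colsIn, funext_iff, Prod.forall, kronecker_one_mulVec,
    Pi.zero_apply]
  exact forall_comm

variable [Fintype ι] [Fintype κ] {ρ σ : Type*} [Fintype ρ] [Fintype σ] [DecidableEq ρ]
  [DecidableEq σ]

/-- The arrays whose rows lie in `perp (rowSpace G')` form the kernel of `1 ⊗ₖ G'`, which maps the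
rows of `G ⊗ₖ P'ᵀ` to those of `G ⊗ₖ 1`. -/
lemma isBasisModulo_kronecker {G : Matrix ρ ι F} {P : Matrix ι ρ F} (hP : G * P = 1)
    {G' : Matrix σ κ F} {P' : Matrix κ σ F} (hP' : G' * P' = 1) :
    IsBasisModulo (G ⊗ₖ P'ᵀ) (rowsIn ι (perp (rowSpace G')) ⊓ colsIn κ (rowSpace G))
      (colsIn κ (rowSpace G)) := by
  classical
  have hker (x : ι × κ → F) :
      x ∈ rowsIn ι (perp (rowSpace G')) ↔ x ᵥ* ((1 : Matrix ι ι F) ⊗ₖ G'ᵀ) = 0 := by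
    rw [← perp_rowsIn, ← rowSpace_one_kronecker, mem_perp_rowSpace, ← Matrix.vecMul_transpose,
      ← Matrix.kroneckerMap_transpose, Matrix.transpose_one]
  have hmul : (G ⊗ₖ P'ᵀ) * ((1 : Matrix ι ι F) ⊗ₖ G'ᵀ) = G ⊗ₖ (1 : Matrix σ σ F) := by
    rw [← Matrix.mul_kronecker_mul, Matrix.mul_one, ← Matrix.transpose_mul, hP',
      Matrix.transpose_one]
  have hmem (c : ρ × σ → F) : c ᵥ* (G ⊗ₖ P'ᵀ) ∈ colsIn κ (rowSpace G) := by
    rw [← rowSpace_kronecker_one, mem_rowSpace_iff]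
    refine ⟨c ᵥ* ((1 : Matrix ρ ρ F) ⊗ₖ P'ᵀ), ?_⟩
    rw [Matrix.vecMul_vecMul, ← Matrix.mul_kronecker_mul, Matrix.one_mul, Matrix.mul_one]
  refine ⟨fun c hc => ?_, le_antisymm (sup_le inf_le_right ?_) fun x hx => ?_⟩
  · have hcG : c ᵥ* (G ⊗ₖ (1 : Matrix σ σ F)) = 0 := by
      rw [← hmul, ← Matrix.vecMul_vecMul, (hker _).1 hc.1]
    have h := congrArg (· ᵥ* (P ⊗ₖ (1 : Matrix σ σ F))) hcG
    simpa only [Matrix.vecMul_vecMul, ← Matrix.mul_kronecker_mul, hP, Matrix.mul_one,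
      Matrix.one_kronecker_one, Matrix.vecMul_one, Matrix.zero_vecMul] using h
  · rintro _ hx
    obtain ⟨c, rfl⟩ := mem_rowSpace_iff.1 hx
    exact hmem c
  · obtain ⟨u, rfl⟩ := mem_rowSpace_iff.1 (rowSpace_kronecker_one (κ := κ) G ▸ hx)
    let c := u ᵥ* ((1 : Matrix ρ ρ F) ⊗ₖ G'ᵀ)
    rw [← sub_add_cancel (u ᵥ* (G ⊗ₖ 1)) (c ᵥ* (G ⊗ₖ P'ᵀ))]
    refine Submodule.add_mem_sup ⟨(hker _).2 ?_, sub_mem hx (hmem c)⟩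
      (mem_rowSpace_iff.2 ⟨c, rfl⟩)
    rw [Matrix.sub_vecMul, Matrix.vecMul_vecMul, Matrix.vecMul_vecMul, hmul,
      Matrix.vecMul_vecMul]
    simp only [← Matrix.mul_kronecker_mul, Matrix.mul_one, Matrix.one_mul, sub_self]

end ProductCode

/-! ### Hypergraph product codes -/

section MinDistance

variable {F : Type*} [Field F] {ι κ : Type*}

/-- The code `C` has minimum distance `d`, that is, `d` is the least Hamming weight of a nonzero
codeword. -/
def IsMinDistance (C : Submodule F (ι → F)) (d : ℕ) : Prop :=
  IsLeast {w | ∃ v ∈ C, v ≠ 0 ∧ (Function.support v).ncard = w} d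

variable [Fintype ι] {C : Submodule F (κ → F)} {E : Submodule F (ι → F)} {x : ι × κ → F} {d : ℕ}

/-- The vector is the combination of the rows of `x` with coefficients `e`, for some `e ∈ E` that is
not orthogonal to the columns of `x`; the summand of `x` in `colsIn κ (perp E)` drops out. -/
lemma exists_support_subset_image_snd (hx : x ∈ rowsIn ι C ⊔ colsIn κ (perp E))
    (hx' : x ∉ colsIn κ (perp E)) :
    ∃ v ∈ C, v ≠ 0 ∧ Function.support v ⊆ Prod.snd '' Function.support x := by
  simp only [mem_colsIn, mem_perp, not_forall] at hx'
  obtain ⟨j, e, he, hej⟩ := hx'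
  refine ⟨fun j => e ⬝ᵥ fun i => x (i, j), ?_, fun h => hej (congrFun h j), fun j hj => ?_⟩
  · obtain ⟨y, hy, z, hz, rfl⟩ := Submodule.mem_sup.1 hx
    have hsum : (fun j => e ⬝ᵥ fun i => (y + z) (i, j)) = ∑ i, e i • fun j => y (i, j) := by
      ext j
      have hyz : (fun i => (y + z) (i, j)) = (fun i => y (i, j)) + fun i => z (i, j) := rfl
      rw [hyz, dotProduct_add, mem_perp.1 (mem_colsIn.1 hz j) e he, add_zero, Finset.sum_apply]
      rfl
    rw [hsum]
    exact sum_mem fun i _ => C.smul_mem _ (mem_rowsIn.1 hy i)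
  · obtain ⟨i, -, hi⟩ := Finset.exists_ne_zero_of_sum_ne_zero hj
    exact ⟨(i, j), right_ne_zero_of_mul hi, rfl⟩

lemma IsMinDistance.le_ncard_support_of_notMem_colsIn [Finite κ] (hC : IsMinDistance C d)
    (hx : x ∈ rowsIn ι C ⊔ colsIn κ (perp E)) (hx' : x ∉ colsIn κ (perp E)) :
    d ≤ (Function.support x).ncard := by
  obtain ⟨v, hv, hv0, hsupp⟩ := exists_support_subset_image_snd hx hx'
  exact (hC.2 ⟨v, hv, hv0, rfl⟩).trans ((Set.ncard_le_ncard hsupp).trans Set.ncard_image_le)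

lemma IsMinDistance.le_ncard_support_of_notMem_rowsIn [Finite κ] {x : κ × ι → F}
    (hC : IsMinDistance C d) (hx : x ∈ colsIn ι C ⊔ rowsIn κ (perp E))
    (hx' : x ∉ rowsIn κ (perp E)) : d ≤ (Function.support x).ncard := by
  have hswap : x ∘ Prod.swap ∈ rowsIn ι C ⊔ colsIn κ (perp E) := by
    obtain ⟨y, hy, z, hz, rfl⟩ := Submodule.mem_sup.1 hx
    exact Submodule.add_mem_sup (mem_rowsIn.2 (mem_colsIn.1 hy)) (mem_colsIn.2 (mem_rowsIn.1 hz))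
  refine (hC.le_ncard_support_of_notMem_colsIn hswap fun h =>
    hx' (mem_rowsIn.2 (mem_colsIn.1 h))).trans_eq ?_
  rw [Function.support_comp_eq_preimage, ← Set.image_swap_eq_preimage_swap,
    Set.ncard_image_of_injective _ Prod.swap_injective]

end MinDistance

section HypergraphProduct

variable {F : Type*} [Field F] {ι κ : Type*} [Fintype ι] {H : Matrix κ ι F}
  {C : Submodule F (ι → F)} {d : ℕ}

lemma IsParityCheck.rowSpace_eq_perp (hH : IsParityCheck H C) : rowSpace H = perp C := by
  have h : C = perp (rowSpace H) := by
    ext x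
    rw [mem_perp_rowSpace, hH x]
  rw [h, perp_perp]

lemma singleRow_notMem_colsIn_perp [DecidableEq ι] {v : ι → F} (hv : v ∈ C) {i : ι}
    (hi : v i ≠ 0) : singleRow i v ∉ colsIn ι (perp C) := by
  intro h
  have hcol : (fun i' => singleRow i v (i', i)) = Pi.single i (v i) := by
    ext i'
    obtain rfl | hi' := eq_or_ne i' i
    · simp [singleRow]
    · simp [singleRow, hi']
  have hdot := mem_perp.1 (mem_colsIn.1 h i) v hv
  rw [hcol, dotProduct_single] at hdot
  exact mul_ne_zero hi hi hdot

lemma exists_mul_eq_one_of_linearIndependent_row {ρ : Type*} [Finite ρ] [DecidableEq ρ]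
    {G : Matrix ρ ι F} (hG : LinearIndependent F G.row) : ∃ P : Matrix ι ρ F, G * P = 1 := by
  cases nonempty_fintype ρ
  rw [← Matrix.mulVec_surjective_iff_exists_right_inverse]
  exact LinearMap.range_eq_top.1 (Submodule.eq_top_of_finrank_eq
    (hG.rank_matrix.trans (Module.finrank_fintype_fun_eq_card F).symm))

variable (p : ℕ) [Fact p.Prime] [Fintype F] [Algebra (ZMod p) F] [DecidableEq ι]

lemma shpGauge_eq_pauliSubgroup (hH : IsParityCheck H C) :
    shpGauge p H = pauliSubgroup p (rowsIn ι (perp C)) (colsIn ι (perp C)) := by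
  rw [shpGauge, cssGauge_eq_pauliSubgroup, rowSpace_one_kronecker, rowSpace_kronecker_one,
    hH.rowSpace_eq_perp]

lemma pauli_mem_pauliCentralizer_cssStabilizer_shpGauge (hH : IsParityCheck H C) {c : ℂˣ}
    {b a : ι × ι → F} :
    pauli p c b a ∈ pauliCentralizer p (cssStabilizer p (shpGauge p H)) ↔
      c ∈ phases p ∧ b ∈ colsIn ι C ⊔ rowsIn ι (perp C) ∧ a ∈ rowsIn ι C ⊔ colsIn ι (perp C) := by
  rw [shpGauge_eq_pauliSubgroup p hH, cssStabilizer_pauliSubgroup, pauliCentralizer_stabilizerGroup,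
    pauli_mem_pauliSubgroup]
  simp only [perp_inf, perp_perp, perp_rowsIn, perp_colsIn, sup_comm]

lemma isLeast_weight_shpGauge (hH : IsParityCheck H C) (hC : IsMinDistance C d) :
    IsLeast {w : ℕ | ∃ c ∈ phases p, ∃ b a : ι × ι → F,
      pauli p c b a ∈ pauliCentralizer p (cssStabilizer p (shpGauge p H)) ∧
      pauli p c b a ∉ shpGauge p H ∧ weight b a = w} d := by
  have hgauge := shpGauge_eq_pauliSubgroup p hH
  constructor
  · obtain ⟨v, hv, hv0, rfl⟩ := hC.1
    obtain ⟨i, hi⟩ := Function.ne_iff.1 hv0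
    refine ⟨1, one_mem _, 0, singleRow i v, ?_, fun h => ?_, ?_⟩
    · exact (pauli_mem_pauliCentralizer_cssStabilizer_shpGauge p hH).2
        ⟨one_mem _, zero_mem _, Submodule.mem_sup_left (singleRow_mem_rowsIn i hv)⟩
    · rw [hgauge, pauli_mem_pauliSubgroup] at h
      exact singleRow_notMem_colsIn_perp hv hi h.2.2
    · have hweight : weight 0 (singleRow i v) = (Function.support (singleRow i v)).ncard := by
        simp [weight, Function.support]
      rw [hweight, support_singleRow, Set.ncard_image_of_injective _ (Prod.mk_right_injective i)]
  · rintro _ ⟨c, hc, b, a, hmem, hnotMem, rfl⟩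
    obtain ⟨-, hb, ha⟩ := (pauli_mem_pauliCentralizer_cssStabilizer_shpGauge p hH).1 hmem
    by_cases hb' : b ∈ rowsIn ι (perp C)
    · have ha' : a ∉ colsIn ι (perp C) := fun ha' =>
        hnotMem (hgauge ▸ (pauli_mem_pauliSubgroup p).2 ⟨hc, hb', ha'⟩)
      exact (hC.le_ncard_support_of_notMem_colsIn ha ha').trans
        (Set.ncard_le_ncard fun _ h => Or.inr h)
    · exact (hC.le_ncard_support_of_notMem_rowsIn hb hb').trans
        (Set.ncard_le_ncard fun _ h => Or.inl h)

lemma exists_encodes_shpGauge {k : ℕ} {G : Matrix (Fin k) ι F} (hG : LinearIndependent F G.row)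
    (hH : IsParityCheck H (rowSpace G)) :
    ∃ g, Encodes p (shpGauge p H) (cssStabilizer p (shpGauge p H)) (k ^ 2) g := by
  obtain ⟨P, hP⟩ := exists_mul_eq_one_of_linearIndependent_row hG
  have hL := isBasisModulo_kronecker hP hP
  rw [← perp_perp (colsIn _ _), perp_colsIn] at hL
  rw [shpGauge_eq_pauliSubgroup p hH]
  exact exists_encodes_pauliSubgroup p
    (hL.submatrix_equiv ((finCongr (sq k)).trans finProdFinEquiv.symm))

theorem isSubsystemCode_shpGauge {k : ℕ} {G : Matrix (Fin k) ι F}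
    (hG : LinearIndependent F G.row) (hH : IsParityCheck H (rowSpace G))
    (hd : IsMinDistance (rowSpace G) d) :
    IsSubsystemCode p (shpGauge p H) (cssStabilizer p (shpGauge p H)) (Fintype.card ι ^ 2) (k ^ 2)
      d where
  gauge_le := shpGauge_eq_pauliSubgroup p hH ▸ pauliSubgroup_le_pauliGroup p
  stabilizer := shpGauge_eq_pauliSubgroup p hH ▸ isStabilizerOf_cssStabilizer p _ _
  length := by rw [Fintype.card_prod, sq]
  encodes := exists_encodes_shpGauge p hG hH
  distance := isLeast_weight_shpGauge p hH hd

end HypergraphProduct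

/-! ### Simplex codes -/

section SimplexCode

variable {F : Type*} [Field F]

lemma ncard_setOf_dotProduct_ne_zero [Fintype F] {ρ : Type*} [Fintype ρ] {u : ρ → F} (hu : u ≠ 0) :
    {x | u ⬝ᵥ x ≠ 0}.ncard = (Fintype.card F - 1) * Fintype.card F ^ (Fintype.card ρ - 1) := by
  classical
  let f : Module.Dual F (ρ → F) := dotProductEquiv F ρ u
  have hrank : Module.finrank F (LinearMap.ker f) + 1 = Fintype.card ρ := by
    rw [Module.Dual.finrank_ker_add_one_of_ne_zero ((LinearEquiv.map_ne_zero_iff _).2 hu),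
      Module.finrank_fintype_fun_eq_card]
  have hker : (LinearMap.ker f : Set (ρ → F)).ncard = Fintype.card F ^ (Fintype.card ρ - 1) := by
    rw [← Nat.card_coe_set_eq, SetLike.coe_sort_coe, Module.natCard_eq_pow_finrank (K := F),
      Nat.card_eq_fintype_card, ← hrank, Nat.add_sub_cancel]
  have hcompl : {x | u ⬝ᵥ x ≠ 0} = (LinearMap.ker f : Set (ρ → F))ᶜ := rfl
  rw [hcompl, Set.ncard_compl, hker, Nat.card_eq_fintype_card, Fintype.card_fun, ← hrank,
    Nat.add_sub_cancel, pow_succ', Nat.sub_mul, one_mul]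

namespace IsSimplexGenerator

variable {ι : Type*} {r : ℕ} {G : Matrix (Fin r) ι F} {u : Fin r → F}

lemma exists_smul_col (hG : IsSimplexGenerator G) {x : Fin r → F} (hx : x ≠ 0) :
    ∃ (c : Fˣ) (j : ι), c • G.col j = x := by
  obtain ⟨h0, -, hsurj⟩ := hG
  obtain ⟨j, hj⟩ := hsurj (Projectivization.mk F x hx)
  obtain ⟨c, hc⟩ := (Projectivization.mk_eq_mk_iff F _ _ _ _).1 hj.symm
  exact ⟨c, j, hc⟩

lemma smul_col_injective (hG : IsSimplexGenerator G) :
    Function.Injective fun x : Fˣ × ι => x.1 • G.col x.2 := by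
  obtain ⟨h0, hinj, -⟩ := hG
  rintro ⟨c, j⟩ ⟨c', j'⟩ (h : c • G.col j = c' • G.col j')
  obtain rfl : j = j' := by
    refine hinj ((Projectivization.mk_eq_mk_iff F _ _ _ _).2 ⟨c⁻¹ * c', ?_⟩)
    rw [mul_smul, ← h, inv_smul_smul]
  exact Prod.ext (Units.ext (smul_left_injective F (h0 j) h)) rfl

lemma card_eq [Fintype F] [Fintype ι] (hG : IsSimplexGenerator G) :
    Fintype.card ι = (Fintype.card F ^ r - 1) / (Fintype.card F - 1) := by
  obtain ⟨_, hbij⟩ := hG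
  rw [← Nat.card_eq_fintype_card, Nat.card_eq_of_bijective _ hbij, Projectivization.card'']
  simp only [Nat.card_eq_fintype_card, Fintype.card_fun, Fintype.card_fin]

lemma vecMul_injective (hG : IsSimplexGenerator G) : Function.Injective G.vecMul := by
  refine (injective_iff_map_eq_zero G.vecMulLinear).2 fun u hu => dotProduct_eq_zero u fun x => ?_
  obtain rfl | hx := eq_or_ne x 0
  · exact dotProduct_zero u
  · obtain ⟨c, j, rfl⟩ := hG.exists_smul_col hx
    rw [Units.smul_def, dotProduct_smul]
    exact (congrArg _ (congrFun hu j)).trans (smul_zero _)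

lemma ncard_support_vecMul [Fintype F] (hG : IsSimplexGenerator G) (hu : u ≠ 0) :
    (Function.support (u ᵥ* G)).ncard = Fintype.card F ^ (r - 1) := by
  have himage : (fun x : Fˣ × ι => x.1 • G.col x.2) '' Set.univ ×ˢ Function.support (u ᵥ* G) =
      {x | u ⬝ᵥ x ≠ 0} := by
    have hdot (c : Fˣ) (j : ι) : u ⬝ᵥ (c • G.col j) ≠ 0 ↔ j ∈ Function.support (u ᵥ* G) :=
      (dotProduct_smul c u (G.col j)).symm ▸ (smul_ne_zero_iff_ne c)
    ext x
    constructor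
    · rintro ⟨⟨c, j⟩, ⟨-, hj⟩, rfl⟩
      exact (hdot c j).2 hj
    · intro hx
      obtain ⟨c, j, rfl⟩ := hG.exists_smul_col fun h : x = 0 => hx (h ▸ dotProduct_zero u)
      exact ⟨(c, j), ⟨trivial, (hdot c j).1 hx⟩, rfl⟩
  have hcard := ncard_setOf_dotProduct_ne_zero hu
  rw [← himage, Set.ncard_image_of_injective _ hG.smul_col_injective, Set.ncard_prod,
    Set.ncard_univ, Nat.card_units, Nat.card_eq_fintype_card, Fintype.card_fin] at hcard
  exact Nat.eq_of_mul_eq_mul_left (Nat.sub_pos_of_lt Fintype.one_lt_card) hcard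

lemma isMinDistance [Fintype F] (hG : IsSimplexGenerator G) (hr : r ≠ 0) :
    IsMinDistance (rowSpace G) (Fintype.card F ^ (r - 1)) := by
  have hne {u : Fin r → F} : u ᵥ* G ≠ 0 ↔ u ≠ 0 :=
    map_ne_zero_iff G.vecMulLinear hG.vecMul_injective
  constructor
  · have : NeZero r := ⟨hr⟩
    obtain ⟨u, hu⟩ := exists_ne (0 : Fin r → F)
    exact ⟨u ᵥ* G, mem_rowSpace_iff.2 ⟨u, rfl⟩, hne.2 hu, hG.ncard_support_vecMul hu⟩
  · rintro _ ⟨v, hv, hv0, rfl⟩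
    obtain ⟨u, rfl⟩ := mem_rowSpace_iff.1 hv
    exact (hG.ncard_support_vecMul (hne.1 hv0)).ge

end IsSimplexGenerator

end SimplexCode

end Qudit

end

theorem mainTheorem8_general (p : ℕ) [Fact p.Prime] {F : Type*} [Field F] [Fintype F]
    [Algebra (ZMod p) F] (q : ℕ) (hq : Fintype.card F = q) (r : ℕ) (hr : r ≠ 0)
    {ι κ : Type*} [Fintype ι] [DecidableEq ι]
    (G : Matrix (Fin r) ι F) (hG : Qudit.IsSimplexGenerator G)
    (H : Matrix κ ι F) (hH : Qudit.IsParityCheck H (Qudit.rowSpace G)) :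
    Qudit.IsSubsystemCode p (Qudit.shpGauge p H) (Qudit.cssStabilizer p (Qudit.shpGauge p H))
      (((q ^ r - 1) / (q - 1)) ^ 2) (r ^ 2) (q ^ (r - 1)) := by
  subst hq
  rw [← hG.card_eq]
  exact Qudit.isSubsystemCode_shpGauge p (Matrix.vecMul_injective_iff.1 hG.vecMul_injective) hH
    (hG.isMinDistance hr)

theorem mainTheorem8 (p : ℕ) [Fact p.Prime] {F : Type*} [Field F] [Fintype F]
    [Algebra (ZMod p) F] (q : ℕ) (hq : Fintype.card F = q) (r : ℕ) (hr : 3 ≤ r)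
    {ι κ : Type*} [Fintype ι] [DecidableEq ι] [Fintype κ]
    (G : Matrix (Fin r) ι F) (hG : Qudit.IsSimplexGenerator G)
    (H : Matrix κ ι F) (hH : Qudit.IsParityCheck H (Qudit.rowSpace G)) :
    Qudit.IsSubsystemCode p (Qudit.shpGauge p H) (Qudit.cssStabilizer p (Qudit.shpGauge p H))
      (((q ^ r - 1) / (q - 1)) ^ 2) (r ^ 2) (q ^ (r - 1)) :=
  mainTheorem8_general p q hq r (by omega) G hG H hH
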